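/- Let $\overrightarrow{K}_n$ be the transitive tournament on $[n]=\{1,\dots,n\}$, the directed graph with an edge $i\to j$ exactly when $i<j$. For finite directed graphs $G,H$, let $\mathrm{Hom}(G,H)$ be the polyhedral subcomplex of $\prod_{v\in V(G)}\Delta^{V(H)}$ ($\Delta^{S}$ denotes the simplex with vertex set $S$) whose cells are the products $\prod_{v\in V(G)}\Delta^{\alpha(v)}$, where $\alpha$ runs over the maps that assign to each $v\in V(G)$ a nonempty set $\alpha(v)\subseteq V(H)$ such that $\alpha(v)\times\alpha(w)\subseteq E(H)$ for every $(v,w)\in E(G)$. For $a\ge 1$ and $b\ge 0$ let $\Delta^b=\mathrm{conv}\{e_0,\dots,e_b\}\subset\mathbb{R}^b$, where $e_0=0$ and $e_1,\dots,e_b$ is the standard basis. Draw the complete bipartite graph $K_{a,b+1}$ in the plane with straight edges, with the vertices of its two colour classes at $(0,1),\dots,(0,a)$ and at $(1,1),\dots,(1,b+1)$; write $i$ for the vertex at $(0,i)$ and $j$ for the vertex at $(1,j+1)$, $0\le j\le b$. A spanning tree $T$ is noncrossing if no two distinct edges of $T$ meet outside of their end points. It defines the Minkowski cell $\Delta_T=\sum_{i=1}^a\Delta^{N_T(i)}$,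 where $N_T(i)\subseteq\{0,\dots,b\}$ is the set of neighbours of $i$ in $T$ and $\Delta^{S}=\mathrm{conv}\{e_j:j\in S\}$. Let $\mathcal{T}^a_b$ be the polyhedral complex whose maximal cells are the $\Delta_T$, for $T$ a noncrossing spanning tree of $K_{a,b+1}$, and whose cells are all nonempty faces of these (the staircase subdivision). Let $2\le m\le n$. Then the cells $\Delta_T$ form a mixed subdivision $\mathcal{T}^m_{n-m}$ of $m\Delta^{n-m}$: each $\Delta_T$ is a full-dimensional Minkowski sum of $m$ polytopes whose vertices are vertices of $\Delta^{n-m}$, the union of the cells is $m\Delta^{n-m}$, and for any two noncrossing spanning trees $T,T'$ and every $i$ the set $\Delta^{N_T(i)}\cap\Delta^{N_{T'}(i)}$ is a (possibly empty) face of $\Delta^{N_T(i)}$ and of $\Delta^{N_{T'}(i)}$, and $\Delta_T\cap\Delta_{T'}=\sum_{i=1}^m\bigl(\Delta^{N_T(i)}\cap\Delta^{N_{T'}(i)}\bigr)$. The complex $\mathrm{Hom}(\overrightarrow{K}_m,\overrightarrow{K}_n)$ is homeomorphic to $\mathcal{T}^m_{n-m}$ as a polyhedral complex: there is a homeomorphism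 between the underlying spaces under which the cells of the one correspond exactly to the cells of the other. In particular, the underlying space of $\mathrm{Hom}(\overrightarrow{K}_m,\overrightarrow{K}_n)$ is homeomorphic to a closed ball of dimension $n-m$. -/

import Mathlib

open scoped Pointwise

namespace TournamentHom

noncomputable section

/-! ### Hom complexes of directed graphs -/

/-- A multihomomorphism `G → H`: a map from the vertices of `G` to nonempty sets of vertices of `H`
such that `α v × α w ⊆ E(H)` for every edge `(v, w)` of `G`. -/
structure MultiHom {V W : Type*} (G : Digraph V) (H : Digraph W) where
  toFun : V → Set W
  nonempty : ∀ v, (toFun v).Nonempty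
  adj : ∀ v w, G.Adj v w → ∀ x ∈ toFun v, ∀ y ∈ toFun w, H.Adj x y

/-- The face, with vertex set `S`, of the standard simplex whose vertex set is `W`. -/
def simplexFace {W : Type*} [Fintype W] (S : Set W) : Set (W → ℝ) :=
  {p | p ∈ stdSimplex ℝ W ∧ ∀ w, w ∉ S → p w = 0}

/-- The cell `∏ v, Δ^{α v}` of the product `∏ v, Δ^W` given by a multihomomorphism `α`. -/
def MultiHom.cell {V W : Type*} [Fintype W] {G : Digraph V} {H : Digraph W}
    (α : MultiHom G H) : Set (V → W → ℝ) :=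
  Set.univ.pi fun v => simplexFace (α.toFun v)

/-- The polyhedral complex `Hom(G, H)`, given as its set of (nonempty, closed) cells
inside the product `∏ v, Δ^W`. -/
def homComplex {V W : Type*} [Fintype W] (G : Digraph V) (H : Digraph W) :
    Set (Set (V → W → ℝ)) :=
  Set.range fun α : MultiHom G H => α.cell

/-- The transitive tournament on `n` vertices: there is an edge `i → j` exactly when `i < j`. -/
def transTournament (n : ℕ) : Digraph (Fin n) where
  Adj i j := i < j

/-! ### Geometric complexes -/

/-- The underlying space of a (finite) complex given by its set of closed cells. -/
def support {E : Type*} (K : Set (Set E)) : Set E := ⋃₀ K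

/-- `h` identifies the cells of `K` with the cells of `L`: a subset of the underlying space of `K`
is a cell of `K` if and only if its image under `h` is a cell of `L`. -/
def PreservesCells {E F : Type*} [TopologicalSpace E] [TopologicalSpace F]
    (K : Set (Set E)) (L : Set (Set F)) (h : support K ≃ₜ support L) : Prop :=
  ∀ A : Set (support K),
    ((Subtype.val '' A : Set E) ∈ K ↔ (Subtype.val '' (h '' A) : Set F) ∈ L)

/-! ### Mixed subdivisions -/

/-- A Minkowski cell of `∑ i, P i`, recorded through its summands `C i`: each `C i` is a polytope
whose vertices are vertices of `P i`, and `∑ i, C i` is full-dimensional. -/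
def IsMinkowskiCell {ι E : Type*} [Fintype ι] [NormedAddCommGroup E] [NormedSpace ℝ E]
    (P C : ι → Set E) : Prop :=
  (∀ i, ∃ S : Set E, S.Finite ∧ S ⊆ (P i).extremePoints ℝ ∧ C i = convexHull ℝ S) ∧
    affineSpan ℝ (∑ i, C i) = ⊤

/-- A mixed subdivision of `∑ i, P i`: a collection of Minkowski cells with union `∑ i, P i` such
that for any two of them, `C` and `C'`, each `C i ∩ C' i` is a (possibly empty) face of `C i` and
of `C' i`, and the two cells intersect in the Minkowski sum of the `C i ∩ C' i`. -/
structure IsMixedSubdivision {ι E : Type*} [Fintype ι] [NormedAddCommGroup E] [NormedSpace ℝ E]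
    (P : ι → Set E) (𝒮 : Set (ι → Set E)) : Prop where
  isMinkowskiCell : ∀ C ∈ 𝒮, IsMinkowskiCell P C
  union_eq : ⋃ C ∈ 𝒮, ∑ i, C i = ∑ i, P i
  face_left : ∀ C ∈ 𝒮, ∀ C' ∈ 𝒮, ∀ i, IsExposed ℝ (C i) (C i ∩ C' i)
  face_right : ∀ C ∈ 𝒮, ∀ C' ∈ 𝒮, ∀ i, IsExposed ℝ (C' i) (C i ∩ C' i)
  inter_eq : ∀ C ∈ 𝒮, ∀ C' ∈ 𝒮, (∑ i, C i) ∩ (∑ i, C' i) = ∑ i, C i ∩ C' i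

/-- The polyhedral complex of a subdivision given by its maximal cells: its cells are all nonempty
faces of the polytopes `∑ i, C i`. -/
def subdivisionComplex {ι E : Type*} [Fintype ι] [NormedAddCommGroup E] [NormedSpace ℝ E]
    (𝒮 : Set (ι → Set E)) : Set (Set E) :=
  {F | F.Nonempty ∧ ∃ C ∈ 𝒮, IsExposed ℝ (∑ i, C i) F}

/-! ### The staircase subdivision -/

/-- The points `e_0 = 0, e_1, …, e_b` of `ℝ^b`. -/
def simplexVertex (b : ℕ) : Fin (b + 1) → EuclideanSpace ℝ (Fin b) :=
  Fin.cases 0 fun j => EuclideanSpace.single j 1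

/-- The simplex `Δ^b = conv {e_0, …, e_b}` in `ℝ^b`. -/
def simplex (b : ℕ) : Set (EuclideanSpace ℝ (Fin b)) :=
  convexHull ℝ (Set.range (simplexVertex b))

/-- The position in the plane of the vertices of `K_{a,b+1}`: the first colour class is placed at
`(0, 1), …, (0, a)`, the second one at `(1, 1), …, (1, b + 1)`. -/
def position (a b : ℕ) : Fin a ⊕ Fin (b + 1) → ℝ × ℝ :=
  Sum.elim (fun i => (0, (i : ℝ) + 1)) (fun j => (1, (j : ℝ) + 1))

/-- The straight line drawing of the subgraph `T` of `K_{a,b+1}` has no crossings: distinct edges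
do not meet outside of their end points. -/
def NonCrossing {a b : ℕ} (T : SimpleGraph (Fin a ⊕ Fin (b + 1))) : Prop :=
  ∀ (i i' : Fin a) (j j' : Fin (b + 1)),
    T.Adj (Sum.inl i) (Sum.inr j) → T.Adj (Sum.inl i') (Sum.inr j') → (i, j) ≠ (i', j') →
      Disjoint
        (openSegment ℝ (position a b (Sum.inl i)) (position a b (Sum.inr j)))
        (openSegment ℝ (position a b (Sum.inl i')) (position a b (Sum.inr j')))

/-- The simplices `conv {e_j : j ∈ N(i)}`, for `i = 1, …, a`, where `N(i)` is the set of
neighbours in `T` of the vertex `i` of the first colour class. -/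
def treeCell {a b : ℕ} (T : SimpleGraph (Fin a ⊕ Fin (b + 1))) (i : Fin a) :
    Set (EuclideanSpace ℝ (Fin b)) :=
  convexHull ℝ (simplexVertex b '' {j | T.Adj (Sum.inl i) (Sum.inr j)})

/-- The staircase subdivision of `a Δ^b`: the collection of the Minkowski cells that are given
by the noncrossing spanning trees of `K_{a,b+1}`. -/
def staircase (a b : ℕ) : Set (Fin a → Set (EuclideanSpace ℝ (Fin b))) :=
  {C | ∃ T : SimpleGraph (Fin a ⊕ Fin (b + 1)),
    T ≤ completeBipartiteGraph (Fin a) (Fin (b + 1)) ∧ T.IsTree ∧ NonCrossing T ∧ C = treeCell T}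

end

end TournamentHom

open TournamentHom

/-! With b = n - m, the sets of a multihomomorphism between the tournaments increase strictly.
Subtracting v from the v-th set turns them into nonempty subsets of {0, …, b} that increase weakly
(`IsOrdered`), and this is a bijection. The staircase side is encoded by the same families.
Noncrossing means weakly ordered neighbourhoods (`nonCrossing_iff`), every ordered family lies in a
staircase of intervals (`exists_intervals_of_isOrdered`), which comes from a noncrossing spanning
tree (`isTree_bipartiteOf`), and subfamilies of a staircase span exactly its faces
(`isExposed_intervals`).

The map `shiftedSum` adds up the shifted points and so sends each cell to the Minkowski sum of the
same family. It is injective because unit masses with weakly ordered supports can be recovered from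
their sum: read from left to right, the total mass is cut into consecutive unit pieces
(`partialSum_eq_clampUnit`, `eq_of_sum_bary_eq`). Cutting an arbitrary point of aΔ^b in this way
shows that the cells cover (`exists_isOrdered_of_mem`). Uniqueness also gives the intersection
property. A continuous injection on a compact space is a homeomorphism onto its image, and aΔ^b is a
convex body, hence a ball. -/

namespace TournamentHom

noncomputable section

section MinkowskiSum

/-! ### Faces of simplices and of Minkowski sums of simplices -/

/-- The point of `ℝ^b` with given barycentric coordinates with respect to `e_0, …, e_b`. -/
def bary (b : ℕ) : (Fin (b + 1) → ℝ) →ₗ[ℝ] EuclideanSpace ℝ (Fin b) :=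
  Fintype.linearCombination ℝ (simplexVertex b)

theorem bary_apply {b : ℕ} (q : Fin (b + 1) → ℝ) : bary b q = ∑ j, q j • simplexVertex b j :=
  Fintype.linearCombination_apply ..

theorem bary_coord {b : ℕ} (q : Fin (b + 1) → ℝ) (j : Fin b) : bary b q j = q j.succ := by
  simp [bary_apply, Fin.sum_univ_succ, simplexVertex, Pi.single_apply]

@[simp]
theorem bary_single {b : ℕ} (j : Fin (b + 1)) : bary b (Pi.single j 1) = simplexVertex b j := by
  simp [bary]

theorem continuous_bary (b : ℕ) : Continuous (bary b) := (bary b).continuous_of_finiteDimensional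

theorem dual_bary {b : ℕ} (l : StrongDual ℝ (EuclideanSpace ℝ (Fin b))) (q : Fin (b + 1) → ℝ) :
    l (bary b q) = ∑ j, q j * l (simplexVertex b j) := by
  simp [bary_apply, map_sum]

/-- Points with the same total weight are determined by their image under `bary`. -/
theorem bary_injective_of_sum_eq {b : ℕ} {p q : Fin (b + 1) → ℝ} (hs : ∑ j, p j = ∑ j, q j)
    (h : bary b p = bary b q) : p = q := by
  have hsucc : ∀ j : Fin b, p j.succ = q j.succ := fun j => by
    rw [← bary_coord p, ← bary_coord q, h]
  funext j
  refine Fin.cases ?_ hsucc j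
  simpa [Fin.sum_univ_succ, hsucc] using hs

/-- The e_j are affinely independent. The constant is forced by e_0 = 0, and it does not affect
which vertices maximise the functional. -/
theorem exists_dual_simplexVertex {b : ℕ} (g : Fin (b + 1) → ℝ) :
    ∃ (l : StrongDual ℝ (EuclideanSpace ℝ (Fin b))) (c : ℝ),
      ∀ j, l (simplexVertex b j) = g j + c := by
  refine ⟨∑ j : Fin b, (g j.succ - g 0) • EuclideanSpace.proj j, -g 0, fun j => ?_⟩
  refine Fin.cases ?_ (fun j => ?_) j
  · simp [simplexVertex]
  · simp [simplexVertex, sub_eq_add_neg]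

section simplexFace

variable {W : Type*} [Fintype W] {S T : Set W} {p : W → ℝ}

theorem mem_simplexFace :
    p ∈ simplexFace S ↔ (∀ w, 0 ≤ p w) ∧ ∑ w, p w = 1 ∧ ∀ w, w ∉ S → p w = 0 := by
  simp [simplexFace, stdSimplex, and_assoc]

theorem simplexFace_mono (h : S ⊆ T) : simplexFace S ⊆ simplexFace T :=
  fun _ hp => ⟨hp.1, fun w hw => hp.2 w fun hS => hw (h hS)⟩

theorem simplexFace_inter : simplexFace (S ∩ T) = simplexFace S ∩ simplexFace T := by
  ext p
  refine ⟨fun hp => ⟨simplexFace_mono Set.inter_subset_left hp,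
    simplexFace_mono Set.inter_subset_right hp⟩, fun hp => ⟨hp.1.1, fun w hw => ?_⟩⟩
  by_cases h : w ∈ S
  · exact hp.2.2 w fun h' => hw ⟨h, h'⟩
  · exact hp.1.2 w h

theorem single_mem_simplexFace [DecidableEq W] {w : W} (hw : w ∈ S) :
    (Pi.single w 1 : W → ℝ) ∈ simplexFace S :=
  ⟨single_mem_stdSimplex ℝ w, fun v hv => Pi.single_eq_of_ne (fun h : v = w => hv (h.symm ▸ hw)) _⟩

theorem nonempty_of_mem_simplexFace (hp : p ∈ simplexFace S) : ∃ w ∈ S, 0 < p w := by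
  rw [mem_simplexFace] at hp
  by_contra! h
  have : ∑ w, p w ≤ 0 := Finset.sum_nonpos fun w _ => by
    by_cases hw : w ∈ S
    · exact h w hw
    · exact (hp.2.2 w hw).le
  linarith [hp.2.1]

theorem isCompact_simplexFace : IsCompact (simplexFace S) := by
  have : simplexFace S = stdSimplex ℝ W ∩ ⋂ w ∈ Sᶜ, {p | p w = 0} := by
    ext p; simp [simplexFace]
  rw [this]
  exact (isCompact_stdSimplex ℝ W).inter_right
    (isClosed_biInter fun w _ => isClosed_eq (continuous_apply w) continuous_const)

theorem convex_simplexFace : Convex ℝ (simplexFace S) := by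
  intro p hp q hq s t hs ht hst
  refine ⟨convex_stdSimplex ℝ W hp.1 hq.1 hs ht hst, fun w hw => ?_⟩
  simp [hp.2 w hw, hq.2 w hw]

end simplexFace

theorem convexHull_simplexVertex {b : ℕ} (S : Set (Fin (b + 1))) :
    convexHull ℝ (simplexVertex b '' S) = bary b '' simplexFace S := by
  classical
  apply Set.Subset.antisymm
  · refine convexHull_min ?_ (convex_simplexFace.linear_image _)
    rintro _ ⟨j, hj, rfl⟩
    exact ⟨Pi.single j 1, single_mem_simplexFace hj, bary_single j⟩
  · rintro _ ⟨p, hp, rfl⟩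
    rw [mem_simplexFace] at hp
    have hz : ∀ x, x ∉ Finset.univ.filter (· ∈ S) → p x = 0 :=
      fun x hx => hp.2.2 x (by simpa using hx)
    rw [bary_apply, ← Finset.sum_subset (Finset.subset_univ (Finset.univ.filter (· ∈ S)))
      (fun x _ hx => by rw [hz x hx, zero_smul])]
    refine (convex_convexHull ℝ _).sum_mem (fun j _ => hp.1 j) ?_ fun j hj =>
      subset_convexHull ℝ _ ⟨j, by simpa using hj, rfl⟩
    rw [← hp.2.1]
    exact Finset.sum_subset (Finset.subset_univ _) fun x _ hx => hz x hx

variable {ι : Type*} [Fintype ι] {b : ℕ}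

/-- The Minkowski sum of the simplices `conv {e_j : j ∈ N i}`. -/
def minkowskiSum (N : ι → Set (Fin (b + 1))) : Set (EuclideanSpace ℝ (Fin b)) :=
  ∑ i, convexHull ℝ (simplexVertex b '' N i)

theorem mem_minkowskiSum {N : ι → Set (Fin (b + 1))} {x : EuclideanSpace ℝ (Fin b)} :
    x ∈ minkowskiSum N ↔
      ∃ q : ι → Fin (b + 1) → ℝ, (∀ i, q i ∈ simplexFace (N i)) ∧ ∑ i, bary b (q i) = x := by
  rw [minkowskiSum, Set.mem_fintype_sum]
  constructor
  · rintro ⟨g, hg, rfl⟩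
    simp_rw [convexHull_simplexVertex] at hg
    choose q hq hqg using hg
    exact ⟨q, hq, by simp_rw [hqg]⟩
  · rintro ⟨q, hq, rfl⟩
    exact ⟨fun i => bary b (q i), fun i => by
      rw [convexHull_simplexVertex]; exact ⟨_, hq i, rfl⟩, rfl⟩

theorem minkowskiSum_mono {N N' : ι → Set (Fin (b + 1))} (h : ∀ i, N i ⊆ N' i) :
    minkowskiSum N ⊆ minkowskiSum N' := fun x hx => by
  rw [mem_minkowskiSum] at hx ⊢
  obtain ⟨q, hq, rfl⟩ := hx
  exact ⟨q, fun i => simplexFace_mono (h i) (hq i), rfl⟩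

/-- The face of a Minkowski sum of simplices in the direction `l` is the Minkowski sum of the
faces of the summands in this direction. -/
theorem minkowskiSum_toExposed (l : StrongDual ℝ (EuclideanSpace ℝ (Fin b)))
    (N N' : ι → Set (Fin (b + 1))) (hN : ∀ i, (N i).Nonempty)
    (hN' : ∀ i, N' i = {j | j ∈ N i ∧ ∀ k ∈ N i, l (simplexVertex b k) ≤ l (simplexVertex b j)}) :
    {x ∈ minkowskiSum N | ∀ y ∈ minkowskiSum N, l y ≤ l x} = minkowskiSum N' := by
  classical
  have hmax : ∀ i, ∃ j ∈ N i, ∀ k ∈ N i, l (simplexVertex b k) ≤ l (simplexVertex b j) :=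
    fun i => (N i).toFinite.exists_maximalFor (fun j => l (simplexVertex b j)) _ (hN i) |>.imp
      fun j hj => ⟨hj.1, fun k hk => (le_total _ _).elim id (hj.2 hk)⟩
  choose t ht htmax using hmax
  set M : ι → ℝ := fun i => l (simplexVertex b (t i)) with hM
  have hsub : ∀ i, N' i ⊆ N i := fun i j hj => by rw [hN'] at hj; exact hj.1
  have hval : ∀ i, ∀ j ∈ N' i, l (simplexVertex b j) = M i := fun i j hj => by
    rw [hN'] at hj
    exact le_antisymm (htmax i j hj.1) (hj.2 _ (ht i))
  -- The amount by which a point falls short of the maximum is a sum of these nonnegative terms, one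
  -- per vertex.
  have hle : ∀ i, ∀ q ∈ simplexFace (N i), ∀ j, 0 ≤ q j * (M i - l (simplexVertex b j)) := by
    intro i q hq j
    by_cases hj : j ∈ N i
    · exact mul_nonneg (hq.1.1 j) (sub_nonneg.2 (htmax i j hj))
    · rw [hq.2 j hj, zero_mul]
  have hdiff : ∀ i, ∀ q ∈ simplexFace (N i),
      ∑ j, q j * (M i - l (simplexVertex b j)) = M i - l (bary b q) := by
    intro i q hq
    rw [mem_simplexFace] at hq
    simp_rw [mul_sub, Finset.sum_sub_distrib, ← Finset.sum_mul, hq.2.1, one_mul, dual_bary]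
  ext x
  simp only [Set.mem_ofPred_eq, mem_minkowskiSum]
  constructor
  · rintro ⟨⟨q, hq, rfl⟩, hx⟩
    refine ⟨q, fun i => ⟨(hq i).1, fun j hj => ?_⟩, rfl⟩
    have h1 := hx (∑ i, bary b (Pi.single (t i) 1))
      ⟨_, fun i => single_mem_simplexFace (ht i), rfl⟩
    simp only [bary_single, map_sum] at h1
    -- Comparison with the sum of maximising vertices shows that a maximal point has total deficit
    -- zero, so each term vanishes and no weight sits on a non-maximal vertex.
    have h2 : ∑ i, ∑ j, q i j * (M i - l (simplexVertex b j)) = 0 := by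
      refine le_antisymm ?_ (Finset.sum_nonneg fun i _ => Finset.sum_nonneg fun j _ =>
        hle i _ (hq i) j)
      rw [Finset.sum_congr rfl fun i _ => hdiff i _ (hq i), Finset.sum_sub_distrib]
      linarith
    have h3 := (Finset.sum_eq_zero_iff_of_nonneg fun i _ => Finset.sum_nonneg fun j _ =>
        hle i _ (hq i) j).1 h2 i (Finset.mem_univ i)
    have h4 := (Finset.sum_eq_zero_iff_of_nonneg fun j _ => hle i _ (hq i) j).1 h3 j
      (Finset.mem_univ j)
    by_cases hjN : j ∈ N i
    · refine (mul_eq_zero.1 h4).resolve_right fun h0 => hj ?_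
      rw [hN']
      exact ⟨hjN, fun k hk => (htmax i k hk).trans (sub_nonpos.1 h0.le)⟩
    · exact (hq i).2 j hjN
  · rintro ⟨q, hq, rfl⟩
    refine ⟨⟨q, fun i => simplexFace_mono (hsub i) (hq i), rfl⟩, ?_⟩
    rintro _ ⟨r, hr, rfl⟩
    simp only [map_sum]
    refine Finset.sum_le_sum fun i _ => ?_
    have h1 := hdiff i _ (hr i)
    have h2 := Finset.sum_nonneg fun j (_ : j ∈ Finset.univ) => hle i _ (hr i) j
    have h3 := hdiff i _ (simplexFace_mono (hsub i) (hq i))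
    have h4 : ∑ j, q i j * (M i - l (simplexVertex b j)) = 0 := Finset.sum_eq_zero fun j _ => by
      by_cases hj : j ∈ N' i
      · rw [hval i j hj, sub_self, mul_zero]
      · rw [(hq i).2 j hj, zero_mul]
    linarith

/-- A subfamily that is cut out by one function of the vertices gives a face of a Minkowski sum. -/
theorem isExposed_minkowskiSum {N N' : ι → Set (Fin (b + 1))} (g : Fin (b + 1) → ℝ)
    (hsub : ∀ i, N' i ⊆ N i) (hne : ∀ i, (N' i).Nonempty)
    (hg : ∀ i, ∀ j ∈ N' i, ∀ k ∈ N i, g k ≤ g j ∧ (k ∉ N' i → g k < g j)) :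
    IsExposed ℝ (minkowskiSum N) (minkowskiSum N') := by
  obtain ⟨l, c, hl⟩ := exists_dual_simplexVertex g
  refine fun _ => ⟨l, (minkowskiSum_toExposed l N N' (fun i => (hne i).mono (hsub i)) ?_).symm⟩
  intro i
  ext j
  simp only [hl, add_le_add_iff_right, Set.mem_ofPred_eq]
  refine ⟨fun hj => ⟨hsub i hj, fun k hk => (hg i j hj k hk).1⟩, fun hj => ?_⟩
  by_contra h
  obtain ⟨k, hk⟩ := hne i
  exact absurd ((hg i k hk j hj.1).2 h) (not_lt.2 (hj.2 k (hsub i hk)))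

/-- The indicator function of `S'` cuts out the face; this is the case of a single summand. -/
theorem isExposed_convexHull_simplexVertex {S S' : Set (Fin (b + 1))} (h : S' ⊆ S) :
    IsExposed ℝ (convexHull ℝ (simplexVertex b '' S)) (convexHull ℝ (simplexVertex b '' S')) := by
  classical
  intro hne
  have hne' : S'.Nonempty := by
    rw [convexHull_nonempty_iff] at hne; exact hne.of_image
  have := isExposed_minkowskiSum (ι := Unit) (N := fun _ => S) (N' := fun _ => S')
    (fun j => if j ∈ S' then 1 else 0) (fun _ => h) (fun _ => hne') (fun _ j hj k _ => by
      by_cases hk : k ∈ S' <;> simp [hj, hk])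
  simp only [minkowskiSum, Finset.univ_unique, Finset.sum_singleton] at this
  exact this hne

theorem convexHull_simplexVertex_inter (S T : Set (Fin (b + 1))) :
    convexHull ℝ (simplexVertex b '' S) ∩ convexHull ℝ (simplexVertex b '' T) =
      convexHull ℝ (simplexVertex b '' (S ∩ T)) := by
  simp only [convexHull_simplexVertex, simplexFace_inter]
  refine (Set.InjOn.image_inter (u := stdSimplex ℝ _) ?_ (fun p hp => hp.1) (fun p hp => hp.1)).symm
  exact fun p hp q hq h => bary_injective_of_sum_eq (hp.2.trans hq.2.symm) h

theorem simplexVertex_mem_extremePoints (j : Fin (b + 1)) :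
    simplexVertex b j ∈ (simplex b).extremePoints ℝ := by
  have := isExposed_convexHull_simplexVertex (Set.subset_univ {j})
  rw [Set.image_univ, Set.image_singleton, convexHull_singleton] at this
  exact exposedPoints_subset_extremePoints (mem_exposedPoints_iff_exposed_singleton.2 this)

/-- Exchanging one vertex j for k inside a single summand moves the sum by e_k - e_j. Chains of such
exchanges starting at e_0 = 0 put every e_j into the direction space. -/
theorem affineSpan_minkowskiSum {N : ι → Set (Fin (b + 1))} (hne : ∀ i, (N i).Nonempty)
    (hN : ∀ j, Relation.ReflTransGen (fun j k => ∃ i, j ∈ N i ∧ k ∈ N i) 0 j) :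
    affineSpan ℝ (minkowskiSum N) = ⊤ := by
  classical
  choose t ht using hne
  have hmem : ∀ f : ι → Fin (b + 1), (∀ i, f i ∈ N i) →
      ∑ i, simplexVertex b (f i) ∈ affineSpan ℝ (minkowskiSum N) := fun f hf =>
    subset_affineSpan ℝ _ (mem_minkowskiSum.2
      ⟨fun i => Pi.single (f i) 1, fun i => single_mem_simplexFace (hf i), by simp⟩)
  set D := (affineSpan ℝ (minkowskiSum N)).direction with hD
  have hedge : ∀ i, ∀ j ∈ N i, ∀ k ∈ N i, simplexVertex b k - simplexVertex b j ∈ D := by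
    intro i j hj k hk
    have hup : ∀ j ∈ N i, ∀ i', Function.update t i j i' ∈ N i' := fun j hj i' => by
      rcases eq_or_ne i' i with rfl | h
      · simpa using hj
      · simpa [h] using ht i'
    have := AffineSubspace.vsub_mem_direction (hmem _ (hup k hk)) (hmem _ (hup j hj))
    rw [vsub_eq_sub, ← Finset.sum_sub_distrib, Finset.sum_eq_single i] at this
    · simpa using this
    · intro i' _ h; simp [h]
    · simp
  have hall : ∀ j, simplexVertex b j ∈ D := by
    intro j
    induction hN j with
    | refl => simp [simplexVertex]
    | tail _ h ih =>
      obtain ⟨i, hj, hk⟩ := h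
      simpa using D.add_mem (hedge i _ hj _ hk) ih
  rw [← AffineSubspace.direction_eq_top_iff_of_nonempty ⟨_, hmem t ht⟩, ← hD, eq_top_iff]
  intro x _
  have hx : x = bary b (Fin.cons 0 x) := by ext j; simp [bary_coord]
  rw [hx, bary_apply]
  exact D.sum_mem fun j _ => D.smul_mem _ (hall j)

theorem convex_minkowskiSum (N : ι → Set (Fin (b + 1))) : Convex ℝ (minkowskiSum N) :=
  convex_sum _ fun _ _ => convex_convexHull ℝ _

theorem isCompact_minkowskiSum (N : ι → Set (Fin (b + 1))) : IsCompact (minkowskiSum N) := by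
  have : minkowskiSum N = (fun q : ι → Fin (b + 1) → ℝ => ∑ i, bary b (q i)) ''
      Set.univ.pi fun i => simplexFace (N i) := by
    ext x; simp [mem_minkowskiSum]
  rw [this]
  exact (isCompact_univ_pi fun i => isCompact_simplexFace).image
    (continuous_finsetSum _ fun i _ => (continuous_bary b).comp (continuous_apply i))

theorem sum_simplex_eq_minkowskiSum :
    ∑ _i : ι, simplex b = minkowskiSum fun _ : ι => (Set.univ : Set (Fin (b + 1))) := by
  simp [minkowskiSum, simplex]

theorem sum_simplex_eq_smul (a : ℕ) : ∑ _i : Fin a, simplex b = (a : ℝ) • simplex b := by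
  have hc : Convex ℝ (simplex b) := convex_convexHull ℝ _
  have hne : (simplex b).Nonempty :=
    ⟨_, subset_convexHull ℝ _ ⟨0, rfl⟩⟩
  rw [Finset.sum_const, Finset.card_univ, Fintype.card_fin]
  induction a with
  | zero => simp [hne]
  | succ a ih =>
    rw [succ_nsmul, ih, Nat.cast_succ, hc.add_smul a.cast_nonneg zero_le_one, one_smul]

/-! ### Sums of points with weakly ordered supports -/

/-- A family of nonempty sets each of which lies weakly to the left of all later ones. -/
structure IsOrdered {a b : ℕ} (N : Fin a → Set (Fin (b + 1))) : Prop where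
  nonempty : ∀ i, (N i).Nonempty
  le : ∀ i i', i < i' → ∀ j ∈ N i, ∀ k ∈ N i', j ≤ k

/-- The length of `[v, v + 1] ∩ (-∞, x]`. -/
def clampUnit (v x : ℝ) : ℝ := max 0 (min 1 (x - v))

theorem clampUnit_mono (v : ℝ) : Monotone (clampUnit v) := fun x y h => by
  unfold clampUnit; gcongr

/-- The intervals [v, v + 1] with v < a tile [0, a]. -/
theorem sum_clampUnit (a : ℕ) (x : ℝ) :
    ∑ v : Fin a, clampUnit (v : ℕ) x = max 0 (min (a : ℝ) x) := by
  induction a with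
  | zero => simp
  | succ a ih =>
    rw [Fin.sum_univ_castSucc]
    simp only [Fin.val_castSucc, ih, Fin.val_last]
    rw [clampUnit, Nat.cast_succ]
    clear ih
    have : (0 : ℝ) ≤ a := a.cast_nonneg
    rcases le_total x 0 with h | h <;> rcases le_total x a with h' | h' <;>
      rcases le_total x (a + 1) with h'' | h'' <;>
      grind

/-- The sum of the first `k` entries of a vector. -/
def partialSum (s : Fin (b + 1) → ℝ) (k : ℕ) : ℝ := ∑ j with j.val < k, s j

theorem partialSum_succ (s : Fin (b + 1) → ℝ) (j : Fin (b + 1)) :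
    partialSum s (j + 1) = partialSum s j + s j := by
  have : (Finset.univ.filter fun i : Fin (b + 1) => i.val < j + 1) =
      insert j (Finset.univ.filter fun i : Fin (b + 1) => i.val < j) := by
    ext i; simp [Fin.ext_iff]; omega
  rw [partialSum, this, Finset.sum_insert (by simp), add_comm, partialSum]

@[simp]
theorem partialSum_zero (s : Fin (b + 1) → ℝ) : partialSum s 0 = 0 := by simp [partialSum]

@[simp]
theorem partialSum_top (s : Fin (b + 1) → ℝ) : partialSum s (b + 1) = ∑ j, s j := by
  rw [partialSum, Finset.filter_true_of_mem fun j _ => j.isLt]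

theorem partialSum_sum (q : ι → Fin (b + 1) → ℝ) (k : ℕ) :
    partialSum (∑ i, q i) k = ∑ i, partialSum (q i) k := by
  simp only [partialSum, Finset.sum_apply]
  exact Finset.sum_comm

theorem partialSum_mono {s : Fin (b + 1) → ℝ} (hs : ∀ j, 0 ≤ s j) : Monotone (partialSum s) :=
  fun _ _ h => Finset.sum_le_sum_of_subset_of_nonneg
    (Finset.monotone_filter_right _ fun _ _ hk => hk.trans_le h) fun j _ _ => hs j

/-- The partial sums of points with weakly ordered supports are functions of the partial sums of
their sum. -/
theorem partialSum_eq_clampUnit {a : ℕ} {N : Fin a → Set (Fin (b + 1))} (hN : IsOrdered N)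
    {q : Fin a → Fin (b + 1) → ℝ} (hq : ∀ i, q i ∈ simplexFace (N i)) (v : Fin a) (k : ℕ) :
    partialSum (q v) k = clampUnit (v : ℕ) (partialSum (∑ i, q i) k) := by
  have h0 : ∀ i, 0 ≤ partialSum (q i) k := fun i => Finset.sum_nonneg fun j _ => (hq i).1.1 j
  have hc : ∀ i, partialSum (q i) k + ∑ j with ¬ j.val < k, q i j = 1 := fun i => by
    rw [partialSum, Finset.sum_filter_add_sum_filter_not]; exact (hq i).1.2
  have hc0 : ∀ i, 0 ≤ ∑ j with ¬ j.val < k, q i j := fun i =>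
    Finset.sum_nonneg fun j _ => (hq i).1.1 j
  have h1 : ∀ i, partialSum (q i) k ≤ 1 := fun i => by linarith [hc i, hc0 i]
  -- If some mass of `q i` sits at or beyond position k, the ordering forbids later points any mass
  -- before k.
  have hlt : ∀ i i', i < i' → partialSum (q i) k < 1 → partialSum (q i') k = 0 := by
    intro i i' hii hi
    have : 0 < ∑ j with ¬ j.val < k, q i j := by linarith [hc i]
    obtain ⟨j, hj, hj'⟩ := Finset.exists_ne_zero_of_sum_ne_zero this.ne'
    have hjN : j ∈ N i := by by_contra h; exact hj' ((hq i).2 j h)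
    refine Finset.sum_eq_zero fun j' hj1 => (hq i').2 j' fun hj2 => ?_
    have := hN.le i i' hii j hjN j' hj2
    simp only [Finset.mem_filter, Finset.mem_univ, true_and] at hj hj1
    exact hj (lt_of_le_of_lt this hj1)
  rw [partialSum_sum]
  have hcard : ∑ i : Fin a, (if i < v then (1 : ℝ) else 0) = (v : ℕ) := by
    rw [Finset.sum_boole, show Finset.univ.filter (· < v) = Finset.Iio v by ext; simp, Fin.card_Iio]
  have hsplit : ∀ f : Fin a → ℝ, ∑ i, f i = ∑ i with i < v, f i + f v + ∑ i with v < i, f i := by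
    intro f
    have : (Finset.univ : Finset (Fin a)) =
        insert v (Finset.univ.filter (· < v) ∪ Finset.univ.filter (v < ·)) := by
      ext i
      simp only [Finset.mem_univ, Finset.mem_insert, Finset.mem_union, Finset.mem_filter, true_and,
        true_iff]
      rcases lt_trichotomy i v with h | h | h <;> simp [h]
    conv_lhs => rw [this]
    rw [Finset.sum_insert (by simp), Finset.sum_union]
    · ring
    · rw [Finset.disjoint_filter]; exact fun i _ h h' => lt_asymm h h'
  have hleft : ∑ i with i < v, partialSum (q i) k ≤ (v : ℕ) := by
    rw [← hcard, Finset.sum_filter]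
    exact Finset.sum_le_sum fun i _ => by split_ifs <;> simp [h1]
  have hleft' : 0 < partialSum (q v) k → ∑ i with i < v, partialSum (q i) k = (v : ℕ) := by
    intro hv
    rw [← hcard, Finset.sum_filter]
    refine Finset.sum_congr rfl fun i _ => ?_
    split_ifs with hi
    · refine le_antisymm (h1 i) (not_lt.1 fun h => hv.ne' (hlt i v hi h))
    · rfl
  have hright : partialSum (q v) k < 1 → ∑ i with v < i, partialSum (q i) k = 0 := fun hv =>
    Finset.sum_eq_zero fun i hi => hlt v i (by simpa using hi) hv
  have hright' : 0 ≤ ∑ i with v < i, partialSum (q i) k := Finset.sum_nonneg fun i _ => h0 i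
  rw [hsplit, clampUnit]
  -- Either the v-th point has not started before k, or all v earlier ones are complete; if it is
  -- itself unfinished, the later ones contribute nothing.
  rcases (h0 v).eq_or_lt with h | h
  · rw [hright (by linarith), ← h, max_eq_left]
    exact (min_le_right _ _).trans (by linarith)
  · rw [hleft' h]
    rcases (h1 v).eq_or_lt with h' | h'
    · rw [h', min_eq_left (by linarith), max_eq_right zero_le_one]
    · rw [hright h', min_eq_right (by linarith), max_eq_right (by linarith)]
      ring

/-- Points with weakly ordered supports are determined by their sum. -/
theorem eq_of_sum_bary_eq {a : ℕ} {N N' : Fin a → Set (Fin (b + 1))} (hN : IsOrdered N)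
    (hN' : IsOrdered N') {q q' : Fin a → Fin (b + 1) → ℝ} (hq : ∀ i, q i ∈ simplexFace (N i))
    (hq' : ∀ i, q' i ∈ simplexFace (N' i)) (h : ∑ i, bary b (q i) = ∑ i, bary b (q' i)) :
    q = q' := by
  rw [← map_sum, ← map_sum] at h
  have hs : ∀ {M : Fin a → Set (Fin (b + 1))} {r : Fin a → Fin (b + 1) → ℝ},
      (∀ i, r i ∈ simplexFace (M i)) → ∑ j, (∑ i, r i) j = a := fun hr => by
    simp only [Finset.sum_apply]
    rw [Finset.sum_comm, Finset.sum_congr rfl fun i _ => (hr i).1.2]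
    simp
  have hsum := bary_injective_of_sum_eq ((hs hq).trans (hs hq').symm) h
  funext v j
  have hpart : ∀ k, partialSum (q v) k = partialSum (q' v) k := fun k => by
    rw [partialSum_eq_clampUnit hN hq, partialSum_eq_clampUnit hN' hq', hsum]
  have h1 := partialSum_succ (q v) j
  have h2 := partialSum_succ (q' v) j
  rw [hpart, hpart] at h1
  linarith

/-- Every point of `a Δ^b` is a sum of points with weakly ordered supports. -/
theorem exists_isOrdered_of_mem {a : ℕ} {x : EuclideanSpace ℝ (Fin b)}
    (hx : x ∈ ∑ _i : Fin a, simplex b) :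
    ∃ N : Fin a → Set (Fin (b + 1)), IsOrdered N ∧ x ∈ minkowskiSum N := by
  rw [sum_simplex_eq_minkowskiSum, mem_minkowskiSum] at hx
  obtain ⟨r, hr, rfl⟩ := hx
  rw [← map_sum]
  set s := ∑ i, r i with hs
  have hs0 : ∀ j, 0 ≤ s j := fun j => by
    rw [hs, Finset.sum_apply]; exact Finset.sum_nonneg fun i _ => (hr i).1.1 j
  have hsum : ∑ j, s j = a := by
    simp only [hs, Finset.sum_apply]
    rw [Finset.sum_comm, Finset.sum_congr rfl fun i _ => (hr i).1.2]
    simp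
  have hmono := partialSum_mono hs0
  have hP0 : ∀ k, 0 ≤ partialSum s k := fun k => Finset.sum_nonneg fun j _ => hs0 j
  have hPa : ∀ k ≤ b + 1, partialSum s k ≤ a := fun k hk => by
    rw [← hsum, ← partialSum_top]; exact hmono hk
  -- Lay the masses `s j` end to end on [0, a]; `q v j` is the length of the j-th block inside [v, v
  -- + 1].
  set q : Fin a → Fin (b + 1) → ℝ := fun v j =>
    clampUnit (v : ℕ) (partialSum s (j + 1)) - clampUnit (v : ℕ) (partialSum s j) with hq
  have hqmem : ∀ i, q i ∈ simplexFace {j | q i j ≠ 0} := fun i => by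
    rw [mem_simplexFace]
    refine ⟨fun j => sub_nonneg.2 (clampUnit_mono _ (hmono (Nat.le_succ _))), ?_, fun j hj => by
      simpa using hj⟩
    simp only [hq]
    rw [Fin.sum_univ_eq_sum_range (fun j => clampUnit (i : ℕ) (partialSum s (j + 1)) -
      clampUnit (i : ℕ) (partialSum s j)),
      Finset.sum_range_sub fun k => clampUnit (i : ℕ) (partialSum s k)]
    have : ((i : ℕ) : ℝ) + 1 ≤ a := by exact_mod_cast i.isLt
    have h0 : (0 : ℝ) ≤ (i : ℕ) := Nat.cast_nonneg _
    rw [partialSum_zero, partialSum_top, hsum, clampUnit, clampUnit, min_eq_left (by linarith),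
      max_eq_right zero_le_one, max_eq_left ((min_le_right _ _).trans (by linarith)), sub_zero]
  refine ⟨fun i => {j | q i j ≠ 0}, ⟨fun i => ?_, fun i i' hii j hj k hk => ?_⟩,
    mem_minkowskiSum.2 ⟨q, hqmem, ?_⟩⟩
  · obtain ⟨j, hj, -⟩ := nonempty_of_mem_simplexFace (hqmem i)
    exact ⟨j, hj⟩
  · by_contra! hkj
    have hii' : ((i : ℕ) : ℝ) + 1 ≤ (i' : ℕ) := by exact_mod_cast hii
    -- Block k < j ends where block j starts or earlier. If that start is at most i + 1, block k
    -- misses the interior of [i', i' + 1]; otherwise block j misses that of [i, i + 1].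
    rcases le_total (partialSum s j) ((i : ℕ) + 1) with h | h
    · refine hk ?_
      have h1 : partialSum s (k + 1) ≤ partialSum s j := hmono (Nat.succ_le_of_lt hkj)
      have h2 : partialSum s k ≤ partialSum s j := hmono (le_of_lt hkj)
      simp only [hq, clampUnit]
      rw [max_eq_left ((min_le_right _ _).trans (by linarith)),
        max_eq_left ((min_le_right _ _).trans (by linarith)), sub_zero]
    · refine hj ?_
      have h1 : partialSum s j ≤ partialSum s (j + 1) := hmono (Nat.le_succ _)
      simp only [hq, clampUnit]
      rw [min_eq_left (by linarith), min_eq_left (by linarith), sub_self]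
  · rw [← map_sum]
    congr 1
    funext j
    simp only [hq, Finset.sum_apply, Finset.sum_sub_distrib, sum_clampUnit]
    rw [min_eq_right (hPa _ (by omega)), min_eq_right (hPa _ (by omega)), max_eq_right (hP0 _),
      max_eq_right (hP0 _), partialSum_succ]
    ring

end MinkowskiSum

section Staircase

/-! ### Noncrossing spanning trees -/

variable {a b : ℕ}

/-- The neighbours, in the second colour class, of the vertices of the first colour class. -/
def nbr (T : SimpleGraph (Fin a ⊕ Fin (b + 1))) (i : Fin a) : Set (Fin (b + 1)) :=
  {j | T.Adj (Sum.inl i) (Sum.inr j)}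

theorem sum_treeCell (T : SimpleGraph (Fin a ⊕ Fin (b + 1))) :
    ∑ i, treeCell T i = minkowskiSum (nbr T) := rfl

theorem mem_openSegment_position {i : Fin a} {j : Fin (b + 1)} {x : ℝ × ℝ} :
    x ∈ openSegment ℝ (position a b (Sum.inl i)) (position a b (Sum.inr j)) ↔
      0 < x.1 ∧ x.1 < 1 ∧ x.2 = (1 - x.1) * i + x.1 * j + 1 := by
  rw [openSegment_eq_image]
  constructor
  · rintro ⟨t, ⟨h0, h1⟩, rfl⟩
    simp only [position, Sum.elim_inl, Sum.elim_inr, Prod.smul_mk, Prod.mk_add_mk, smul_eq_mul]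
    exact ⟨by linarith, by linarith, by ring⟩
  · rintro ⟨h0, h1, h⟩
    refine ⟨x.1, ⟨h0, h1⟩, ?_⟩
    simp only [position, Sum.elim_inl, Sum.elim_inr, Prod.smul_mk, Prod.mk_add_mk, smul_eq_mul]
    exact Prod.ext (by simp) (by rw [h]; ring)

/-- A graph is drawn without crossings exactly when its edges are weakly ordered. -/
theorem nonCrossing_iff {T : SimpleGraph (Fin a ⊕ Fin (b + 1))} :
    NonCrossing T ↔ ∀ i i', i < i' → ∀ j ∈ nbr T i, ∀ k ∈ nbr T i', j ≤ k := by
  constructor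
  · intro h i i' hi j hj k hk
    by_contra! hkj
    have h1 : ((i : ℕ) : ℝ) < (i' : ℕ) := by exact_mod_cast hi
    have h2 : ((k : ℕ) : ℝ) < (j : ℕ) := by exact_mod_cast hkj
    have hpos : 0 < ((i' : ℕ) : ℝ) - (i : ℕ) + ((j : ℕ) - (k : ℕ)) := by linarith
    -- The abscissa at which the two lines have equal height.
    set t : ℝ := (((i' : ℕ) : ℝ) - (i : ℕ)) / (((i' : ℕ) : ℝ) - (i : ℕ) + ((j : ℕ) - (k : ℕ)))
      with ht
    have ht0 : 0 < t := div_pos (by linarith) hpos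
    have ht1 : t < 1 := (div_lt_one hpos).2 (by linarith)
    have hd := Set.disjoint_left.1 (h i i' j k hj hk fun h => hi.ne (congrArg Prod.fst h))
    refine @hd (t, (1 - t) * (i : ℕ) + t * (j : ℕ) + 1)
      (mem_openSegment_position.2 ⟨ht0, ht1, rfl⟩) (mem_openSegment_position.2 ⟨ht0, ht1, ?_⟩)
    have : t * (((i' : ℕ) : ℝ) - (i : ℕ) + ((j : ℕ) - (k : ℕ))) = ((i' : ℕ) : ℝ) - (i : ℕ) := by
      rw [ht, div_mul_cancel₀ _ hpos.ne']
    simp only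
    linarith
  · intro h i i' j j' hj hj' hne
    rw [Set.disjoint_left]
    intro x hx hx'
    rw [mem_openSegment_position] at hx hx'
    obtain ⟨h0, h1, hx⟩ := hx
    have heq := hx.symm.trans hx'.2.2
    have key : ∀ {i i' : Fin a} {j j' : Fin (b + 1)}, j ∈ nbr T i → j' ∈ nbr T i' →
        (1 - x.1) * (i : ℕ) + x.1 * (j : ℕ) + 1 = (1 - x.1) * (i' : ℕ) + x.1 * (j' : ℕ) + 1 →
        ¬ i < i' := by
      intro i i' j j' hj hj' heq hi
      have h2 : ((i : ℕ) : ℝ) < (i' : ℕ) := by exact_mod_cast hi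
      have h3 : ((j : ℕ) : ℝ) ≤ (j' : ℕ) := by exact_mod_cast h i i' hi j hj j' hj'
      have h4 := mul_lt_mul_of_pos_left h2 (sub_pos.2 h1)
      have h5 := mul_le_mul_of_nonneg_left h3 h0.le
      linarith
    obtain rfl : i = i' := le_antisymm (not_lt.1 (key hj' hj heq.symm)) (not_lt.1 (key hj hj' heq))
    refine hne (Prod.ext rfl (Fin.ext ?_))
    have h6 : x.1 * (((j : ℕ) : ℝ) - (j' : ℕ)) = 0 := by linarith
    exact_mod_cast sub_eq_zero.1 ((mul_eq_zero.1 h6).resolve_left h0.ne')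

theorem nbr_nonempty {T : SimpleGraph (Fin a ⊕ Fin (b + 1))}
    (hT : T ≤ completeBipartiteGraph (Fin a) (Fin (b + 1))) (hc : T.Connected) (i : Fin a) :
    (nbr T i).Nonempty := by
  have : Nontrivial (Fin a ⊕ Fin (b + 1)) := ⟨Sum.inl i, Sum.inr 0, by simp⟩
  obtain ⟨v, hv⟩ := hc.preconnected.exists_adj_of_nontrivial (Sum.inl i)
  rcases v with i' | j
  · simpa [completeBipartiteGraph] using hT hv
  · exact ⟨j, hv⟩

theorem isOrdered_nbr {T : SimpleGraph (Fin a ⊕ Fin (b + 1))}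
    (hT : T ≤ completeBipartiteGraph (Fin a) (Fin (b + 1))) (hc : T.Connected)
    (hn : NonCrossing T) : IsOrdered (nbr T) :=
  ⟨nbr_nonempty hT hc, nonCrossing_iff.1 hn⟩

theorem reflTransGen_nbr {T : SimpleGraph (Fin a ⊕ Fin (b + 1))}
    (hT : T ≤ completeBipartiteGraph (Fin a) (Fin (b + 1))) (hc : T.Connected) (j : Fin (b + 1)) :
    Relation.ReflTransGen (fun j k => ∃ i, j ∈ nbr T i ∧ k ∈ nbr T i) 0 j := by
  set R := Relation.ReflTransGen (fun j k : Fin (b + 1) => ∃ i, j ∈ nbr T i ∧ k ∈ nbr T i) 0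
  -- Walks alternate between the colour classes, so the claim at a vertex of the first class is that
  -- all its neighbours are reached.
  suffices h : ∀ v, Relation.ReflTransGen T.Adj (Sum.inr 0) v →
      Sum.elim (fun i => ∀ k ∈ nbr T i, R k) R v from
    h (Sum.inr j) ((SimpleGraph.reachable_iff_reflTransGen _ _).1 (hc.preconnected _ _))
  intro v hv
  induction hv with
  | refl => exact Relation.ReflTransGen.refl
  | @tail u v _ huv ih =>
    rcases u with i | k <;> rcases v with i' | k'
    · simpa [completeBipartiteGraph] using hT huv
    · exact ih k' huv
    · exact fun k'' hk'' => ih.tail ⟨i', huv.symm, hk''⟩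
    · simpa [completeBipartiteGraph] using hT huv

/-! ### Staircases -/

/-- The bipartite graph in which the neighbours of `i` are the elements of `N i`. -/
def bipartiteOf (N : Fin a → Set (Fin (b + 1))) : SimpleGraph (Fin a ⊕ Fin (b + 1)) where
  Adj
    | Sum.inl i, Sum.inr j => j ∈ N i
    | Sum.inr j, Sum.inl i => j ∈ N i
    | _, _ => False
  symm := ⟨by rintro (_ | _) (_ | _) h <;> exact h⟩
  loopless := ⟨by rintro (_ | _) h <;> exact h⟩

theorem bipartiteOf_le (N : Fin a → Set (Fin (b + 1))) :
    bipartiteOf N ≤ completeBipartiteGraph (Fin a) (Fin (b + 1)) := by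
  rintro (i | j) (i' | j') h
  · exact h.elim
  · simp [completeBipartiteGraph]
  · simp [completeBipartiteGraph]
  · exact h.elim

/-- A connected bipartite graph whose edges are weakly ordered is a tree. -/
theorem isTree_bipartiteOf {N : Fin a → Set (Fin (b + 1))} (hN : IsOrdered N)
    (hc : (bipartiteOf N).Connected) : (bipartiteOf N).IsTree := by
  rw [SimpleGraph.isTree_iff_connected_and_card]
  refine ⟨hc, le_antisymm ?_ hc.card_vert_le_card_edgeSet_add_one⟩
  have hedge : ∀ e : (bipartiteOf N).edgeSet, ∃ i j, j ∈ N i ∧ e.1 = s(Sum.inl i, Sum.inr j) := by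
    rintro ⟨e, he⟩
    induction e using Sym2.ind with
    | _ u v =>
      rcases u with i | j <;> rcases v with i' | j'
      · exact False.elim he
      · exact ⟨i, j', he, rfl⟩
      · exact ⟨i', j, he, Sym2.eq_swap⟩
      · exact False.elim he
  choose fi fj hmem heq using hedge
  -- For weakly ordered edges, i + j determines the edge. It takes at most a + b values, which is
  -- exactly the edge count of a tree on a + b + 1 vertices.
  have hcard : Nat.card (bipartiteOf N).edgeSet ≤ Nat.card (Fin (a + b)) := by
    refine Nat.card_le_card_of_injective
      (fun e => (⟨fi e + fj e, by have := (fi e).isLt; have := (fj e).isLt; omega⟩ : Fin (a + b)))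
      fun e e' h => Subtype.ext ?_
    have h' : (fi e : ℕ) + fj e = fi e' + fj e' := congrArg Fin.val h
    rcases lt_trichotomy (fi e) (fi e') with hi | hi | hi
    · have : (fj e : ℕ) ≤ fj e' := hN.le _ _ hi _ (hmem e) _ (hmem e')
      have : (fi e : ℕ) < fi e' := hi
      omega
    · have : fj e = fj e' := Fin.ext (by rw [hi] at h'; omega)
      rw [heq, heq, hi, this]
    · have : (fj e' : ℕ) ≤ fj e := hN.le _ _ hi _ (hmem e') _ (hmem e)
      have : (fi e' : ℕ) < fi e := hi
      omega
  simp only [Nat.card_eq_fintype_card, Fintype.card_fin, Fintype.card_sum] at hcard ⊢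
  omega

/-- The intervals between consecutive values of `t`. -/
def intervals (t : Fin (a + 1) → Fin (b + 1)) (i : Fin a) : Set (Fin (b + 1)) :=
  Set.Icc (t i.castSucc) (t i.succ)

theorem isOrdered_intervals {t : Fin (a + 1) → Fin (b + 1)} (ht : Monotone t) :
    IsOrdered (intervals t) :=
  ⟨fun _ => ⟨_, Set.left_mem_Icc.2 (ht (Fin.castSucc_lt_succ).le)⟩,
    fun _ _ hi _ hj _ hk => hj.2.trans ((ht (Fin.succ_le_castSucc_iff.2 hi)).trans hk.1)⟩

/-- Consecutive intervals share an endpoint, and together they cover {0, …, b}. -/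
theorem connected_intervals {t : Fin (a + 1) → Fin (b + 1)} (ht : Monotone t) (h0 : t 0 = 0)
    (h1 : t (Fin.last a) = Fin.last b) (ha : 0 < a) :
    (bipartiteOf (intervals t)).Connected := by
  set G := bipartiteOf (intervals t)
  have hle : ∀ i : Fin a, t i.castSucc ≤ t i.succ := fun i => ht (Fin.castSucc_lt_succ).le
  have hadj : ∀ i j, j ∈ intervals t i → G.Reachable (Sum.inl i) (Sum.inr j) := fun i j h =>
    SimpleGraph.Adj.reachable h
  have hreach : ∀ k : Fin (a + 1), G.Reachable (Sum.inr 0) (Sum.inr (t k)) := by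
    intro k
    induction k using Fin.induction with
    | zero => rw [h0]
    | succ i ih =>
      exact (ih.trans (hadj i _ (Set.left_mem_Icc.2 (hle i))).symm).trans
        (hadj i _ (Set.right_mem_Icc.2 (hle i)))
  have hinl : ∀ i, G.Reachable (Sum.inr 0) (Sum.inl i) := fun i =>
    (hreach i.castSucc).trans (hadj i _ (Set.left_mem_Icc.2 (hle i))).symm
  have hcover : ∀ j, ∃ i, j ∈ intervals t i := by
    intro j
    by_contra! h
    -- An uncovered j is never overtaken by t, contradicting its last value b. Index 0 is excluded
    -- because j may equal t 0 = 0.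
    have hlt : ∀ k : Fin (a + 1), k ≠ 0 → t k < j := by
      intro k
      induction k using Fin.induction with
      | zero => simp
      | succ i ih =>
        intro _
        by_contra! hj
        refine h i ⟨?_, hj⟩
        by_cases hi : i.castSucc = 0
        · rw [hi, h0]; exact Fin.zero_le _
        · exact (ih hi).le
    have := hlt (Fin.last a) (by rw [Ne, Fin.ext_iff]; simp; omega)
    rw [h1] at this
    exact absurd this (not_lt.2 (Fin.le_last j))
  have hall : ∀ v, G.Reachable (Sum.inr 0) v := by
    rintro (i | j)
    · exact hinl i
    · obtain ⟨i, hi⟩ := hcover j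
      exact (hinl i).trans (hadj i j hi)
  exact ⟨fun u v => (hall u).symm.trans (hall v)⟩

theorem treeCell_bipartiteOf_mem_staircase {t : Fin (a + 1) → Fin (b + 1)} (ht : Monotone t)
    (h0 : t 0 = 0) (h1 : t (Fin.last a) = Fin.last b) (ha : 0 < a) :
    treeCell (bipartiteOf (intervals t)) ∈ staircase a b :=
  ⟨_, bipartiteOf_le _,
    isTree_bipartiteOf (isOrdered_intervals ht) (connected_intervals ht h0 h1 ha),
    nonCrossing_iff.2 (isOrdered_intervals ht).le, rfl⟩

/-- Every weakly ordered family is contained in a staircase. -/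
theorem exists_intervals_of_isOrdered {N : Fin a → Set (Fin (b + 1))} (hN : IsOrdered N)
    (ha : 0 < a) :
    ∃ t : Fin (a + 1) → Fin (b + 1), Monotone t ∧ t 0 = 0 ∧ t (Fin.last a) = Fin.last b ∧
      ∀ i, N i ⊆ intervals t i := by
  classical
  -- The value at k is the largest element of the sets `N i` with i < k, or 0 if there are none. At
  -- the last index the filter keeps everything, which forces the value b.
  refine ⟨fun k => (Finset.univ.filter fun j =>
      k = Fin.last a ∨ ∃ i, Fin.castSucc i < k ∧ j ∈ N i).sup id,
    fun k k' hk => ?_, ?_, ?_, fun i j hj => ⟨Finset.sup_le fun k hk => ?_, ?_⟩⟩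
  · refine Finset.sup_mono (Finset.monotone_filter_right _ fun j _ hj => ?_)
    rcases hj with rfl | ⟨i, hi, hj⟩
    · exact Or.inl (Fin.last_le_iff.1 hk)
    · exact Or.inr ⟨i, hi.trans_le hk, hj⟩
  · have : (0 : Fin (a + 1)) ≠ Fin.last a := by rw [Ne, Fin.ext_iff]; simp; omega
    simp [this, bot_eq_zero]
  · exact le_antisymm (Fin.le_last _) (Finset.le_sup (f := id) (by simp))
  · simp only [Finset.mem_filter, Finset.mem_univ, true_and] at hk
    rcases hk with hk | ⟨i', hi', hk⟩
    · exact absurd hk (Fin.castSucc_lt_last i).ne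
    · exact hN.le i' i (Fin.castSucc_lt_castSucc_iff.1 hi') k hk j hj
  · refine Finset.le_sup (f := id) ?_
    simp only [Finset.mem_filter, Finset.mem_univ, true_and]
    exact Or.inr ⟨i, Fin.castSucc_lt_succ, hj⟩

/-- A subfamily of a staircase spans a face of the Minkowski cell of the staircase. -/
theorem isExposed_intervals {t : Fin (a + 1) → Fin (b + 1)} (ht : Monotone t)
    {N : Fin a → Set (Fin (b + 1))} (hne : ∀ i, (N i).Nonempty) (hN : ∀ i, N i ⊆ intervals t i) :
    IsExposed ℝ (minkowskiSum (intervals t)) (minkowskiSum N) := by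
  classical
  set χ : Fin a → Fin (b + 1) → ℝ := fun i j => if j ∈ N i then 1 else 0 with hχ
  -- Projection onto the i-th interval. It is constant on every other interval, so the sum of the
  -- pulled-back indicators `χ i` restricts on interval i to `χ i` plus a constant: one function
  -- cuts out all the faces at once.
  set cl : Fin a → Fin (b + 1) → Fin (b + 1) :=
    fun i j => max (t i.castSucc) (min j (t i.succ)) with hcl
  have hle : ∀ i : Fin a, t i.castSucc ≤ t i.succ := fun i => ht (Fin.castSucc_lt_succ).le
  have hclamp : ∀ i, ∀ j ∈ intervals t i, ∀ k ∈ intervals t i, ∀ i', i' ≠ i →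
      cl i' j = cl i' k := by
    intro i j hj k hk i' hi
    rcases lt_or_gt_of_ne hi with hi | hi
    · have h := ht (Fin.succ_le_castSucc_iff.2 hi)
      simp only [hcl, min_eq_right (h.trans hj.1), min_eq_right (h.trans hk.1)]
    · have h := ht (Fin.succ_le_castSucc_iff.2 hi)
      simp only [hcl]
      rw [max_eq_left ((min_le_left _ _).trans (hj.2.trans h)),
        max_eq_left ((min_le_left _ _).trans (hk.2.trans h))]
  have hself : ∀ i, ∀ j ∈ intervals t i, cl i j = j := fun i j hj => by
    simp only [hcl, min_eq_left hj.2, max_eq_right hj.1]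
  refine isExposed_minkowskiSum (fun j => ∑ i, χ i (cl i j)) hN hne fun i j hj k hk => ?_
  have hjt := hN i hj
  have hdiff : ∑ i, χ i (cl i j) - ∑ i, χ i (cl i k) = 1 - χ i k := by
    rw [← Finset.sum_sub_distrib, Finset.sum_eq_single i]
    · rw [hself i j hjt, hself i k hk]; simp [hχ, hj]
    · intro i' _ hi; rw [hclamp i j hjt k hk i' hi, sub_self]
    · simp
  by_cases hkN : k ∈ N i
  · have : χ i k = 1 := by simp [hχ, hkN]
    exact ⟨by linarith, fun h => absurd hkN h⟩
  · have : χ i k = 0 := by simp [hχ, hkN]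
    exact ⟨by linarith, fun _ => by linarith⟩

end Staircase

section Tournament

/-! ### The staircase subdivision -/

variable {a b : ℕ}

theorem minkowskiSum_subset (N : Fin a → Set (Fin (b + 1))) :
    minkowskiSum N ⊆ ∑ _i : Fin a, simplex b := by
  rw [sum_simplex_eq_minkowskiSum]
  exact minkowskiSum_mono fun _ => Set.subset_univ _

/-- A common point has the same summands in both decompositions, by `eq_of_sum_bary_eq`. -/
theorem minkowskiSum_inter {N N' : Fin a → Set (Fin (b + 1))} (hN : IsOrdered N)
    (hN' : IsOrdered N') :
    minkowskiSum N ∩ minkowskiSum N' = minkowskiSum fun i => N i ∩ N' i := by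
  apply Set.Subset.antisymm
  · rintro x ⟨hx, hx'⟩
    rw [mem_minkowskiSum] at hx hx' ⊢
    obtain ⟨q, hq, rfl⟩ := hx
    obtain ⟨q', hq', h⟩ := hx'
    obtain rfl := eq_of_sum_bary_eq hN' hN hq' hq h
    exact ⟨q', fun i => by rw [simplexFace_inter]; exact ⟨hq i, hq' i⟩, rfl⟩
  · exact Set.subset_inter (minkowskiSum_mono fun _ => Set.inter_subset_left)
      (minkowskiSum_mono fun _ => Set.inter_subset_right)

theorem iUnion_staircase (ha : 0 < a) :
    ⋃ C ∈ staircase a b, ∑ i, C i = ∑ _i : Fin a, simplex b := by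
  apply Set.Subset.antisymm
  · refine Set.iUnion₂_subset ?_
    rintro C ⟨T, -, -, -, rfl⟩
    exact minkowskiSum_subset _
  · intro x hx
    obtain ⟨N, hN, hxN⟩ := exists_isOrdered_of_mem hx
    obtain ⟨t, ht, h0, h1, hsub⟩ := exists_intervals_of_isOrdered hN ha
    exact Set.mem_iUnion₂.2 ⟨_, treeCell_bipartiteOf_mem_staircase ht h0 h1 ha,
      minkowskiSum_mono hsub hxN⟩

theorem isMixedSubdivision_staircase (ha : 0 < a) :
    IsMixedSubdivision (fun _ : Fin a => simplex b) (staircase a b) where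
  isMinkowskiCell := by
    rintro C ⟨T, hT, htree, hn, rfl⟩
    refine ⟨fun i => ⟨simplexVertex b '' nbr T i, Set.toFinite _, ?_, rfl⟩,
      affineSpan_minkowskiSum (nbr_nonempty hT htree.connected)
        (reflTransGen_nbr hT htree.connected)⟩
    rintro _ ⟨j, -, rfl⟩
    exact simplexVertex_mem_extremePoints j
  union_eq := iUnion_staircase ha
  face_left := by
    rintro C ⟨T, -, -, -, rfl⟩ C' ⟨T', -, -, -, rfl⟩ i
    simp only [treeCell, convexHull_simplexVertex_inter]
    exact isExposed_convexHull_simplexVertex Set.inter_subset_left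
  face_right := by
    rintro C ⟨T, -, -, -, rfl⟩ C' ⟨T', -, -, -, rfl⟩ i
    simp only [treeCell, convexHull_simplexVertex_inter]
    exact isExposed_convexHull_simplexVertex Set.inter_subset_right
  inter_eq := by
    rintro C ⟨T, hT, htree, hn, rfl⟩ C' ⟨T', hT', htree', hn', rfl⟩
    simp only [treeCell, convexHull_simplexVertex_inter]
    exact minkowskiSum_inter (isOrdered_nbr hT htree.connected hn)
      (isOrdered_nbr hT' htree'.connected hn')

theorem support_subdivisionComplex {ι E : Type*} [Fintype ι] [NormedAddCommGroup E]
    [NormedSpace ℝ E] (𝒮 : Set (ι → Set E)) :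
    support (subdivisionComplex 𝒮) = ⋃ C ∈ 𝒮, ∑ i, C i := by
  apply Set.Subset.antisymm
  · rintro x ⟨F, ⟨-, C, hC, hF⟩, hx⟩
    exact Set.mem_iUnion₂.2 ⟨C, hC, hF.subset hx⟩
  · refine Set.iUnion₂_subset fun C hC x hx => ⟨_, ⟨⟨x, hx⟩, C, hC, IsExposed.refl _⟩, hx⟩

/-- The cells of the staircase subdivision are the Minkowski sums given by the weakly ordered
families. -/
theorem mem_subdivisionComplex_staircase (ha : 0 < a) {F : Set (EuclideanSpace ℝ (Fin b))} :
    F ∈ subdivisionComplex (staircase a b) ↔ 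
      ∃ N : Fin a → Set (Fin (b + 1)), IsOrdered N ∧ F = minkowskiSum N := by
  constructor
  · rintro ⟨hne, C, ⟨T, hT, htree, hn, rfl⟩, hF⟩
    obtain ⟨l, hl⟩ := hF hne
    have hord := isOrdered_nbr hT htree.connected hn
    rw [sum_treeCell] at hl
    -- A face only shrinks each neighbourhood to its maximisers of `l`, and weak order passes to
    -- nonempty subsets.
    rw [minkowskiSum_toExposed l _ _ hord.nonempty fun i => rfl] at hl
    refine ⟨_, ⟨fun i => ?_, fun i i' hi j hj k hk => hord.le i i' hi j hj.1 k hk.1⟩, hl⟩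
    obtain ⟨j, hj⟩ := (nbr T i).toFinite.exists_maximalFor (fun j => l (simplexVertex b j)) _
      (hord.nonempty i)
    exact ⟨j, hj.1, fun k hk => (le_total _ _).elim id (hj.2 hk)⟩
  · rintro ⟨N, hN, rfl⟩
    obtain ⟨t, ht, h0, h1, hsub⟩ := exists_intervals_of_isOrdered hN ha
    refine ⟨?_, _, treeCell_bipartiteOf_mem_staircase ht h0 h1 ha,
      isExposed_intervals ht hN.nonempty hsub⟩
    choose f hf using hN.nonempty
    exact ⟨_, mem_minkowskiSum.2 ⟨_, fun i => single_mem_simplexFace (hf i), rfl⟩⟩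

theorem nonempty_homeomorph_closedBall (ha : 0 < a) :
    Nonempty ((∑ _i : Fin a, simplex b : Set (EuclideanSpace ℝ (Fin b))) ≃ₜ
      Metric.closedBall (0 : EuclideanSpace ℝ (Fin b)) 1) := by
  rw [sum_simplex_eq_minkowskiSum]
  set s := minkowskiSum fun _ : Fin a => (Set.univ : Set (Fin (b + 1)))
  have hcomp : IsCompact s := isCompact_minkowskiSum _
  have hconv : Convex ℝ s := convex_minkowskiSum _
  have hint : (interior s).Nonempty := by
    rw [hconv.interior_nonempty_iff_affineSpan_eq_top]
    exact affineSpan_minkowskiSum (fun _ => Set.univ_nonempty)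
      fun j => Relation.ReflTransGen.single ⟨⟨0, ha⟩, trivial, trivial⟩
  obtain ⟨e, -, he, -⟩ := exists_homeomorph_image_interior_closure_frontier_eq_unitBall hconv hint
    hcomp.isBounded
  rw [hcomp.isClosed.closure_eq] at he
  exact ⟨(e.image s).trans (Homeomorph.setCongr he)⟩

/-! ### The Hom complex of two transitive tournaments -/

/-- The vertex `v + j` of the transitive tournament on `a + b` vertices. -/
def shift (v : Fin a) (j : Fin (b + 1)) : Fin (a + b) := ⟨v + j, by omega⟩

theorem shift_injective (v : Fin a) : Function.Injective (shift (b := b) v) := fun j k h => by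
  simpa [shift, Fin.ext_iff] using h

/-- Restricting along `f` discards only coordinates that vanish on the face; extension by zero
reverses it. -/
theorem simplexFace_preimage {W W' : Type*} [Fintype W] [Fintype W'] {f : W → W'}
    (hf : Function.Injective f) {S : Set W'} (hS : S ⊆ Set.range f) :
    (· ∘ f) '' (simplexFace S : Set (W' → ℝ)) = simplexFace (f ⁻¹' S) := by
  classical
  have hsum : ∀ p : W' → ℝ, (∀ w, w ∉ S → p w = 0) → ∑ w, p w = ∑ w, p (f w) := by
    intro p hp
    refine (Finset.sum_of_injOn f hf.injOn (by simp) (fun w _ hw => hp w fun h => ?_)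
      (fun _ _ => rfl)).symm
    obtain ⟨v, rfl⟩ := hS h
    exact hw (by simp)
  apply Set.Subset.antisymm
  · rintro _ ⟨p, hp, rfl⟩
    rw [mem_simplexFace] at hp ⊢
    exact ⟨fun w => hp.1 _, (hsum p hp.2.2).symm.trans hp.2.1, fun w hw => hp.2.2 _ hw⟩
  · intro q hq
    rw [mem_simplexFace] at hq
    have hext : ∀ w, w ∉ S → Function.extend f q 0 w = 0 := by
      intro w hw
      by_cases h : ∃ v, f v = w
      · obtain ⟨v, rfl⟩ := h
        rw [hf.extend_apply]
        exact hq.2.2 v hw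
      · rw [Function.extend_apply' _ _ _ h, Pi.zero_apply]
    refine ⟨Function.extend f q 0, mem_simplexFace.2 ⟨fun w => ?_, ?_, hext⟩,
      funext fun v => hf.extend_apply _ _ _⟩
    · by_cases h : ∃ v, f v = w
      · obtain ⟨v, rfl⟩ := h
        rw [hf.extend_apply]
        exact hq.1 v
      · rw [Function.extend_apply' _ _ _ h, Pi.zero_apply]
    · rw [hsum _ hext, ← hq.2.1]
      exact Finset.sum_congr rfl fun v _ => hf.extend_apply _ _ _

variable (α : MultiHom (transTournament a) (transTournament (a + b)))

/-- Each of the v' - v steps raises the vertex by at least one, so w - v increases weakly.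
Nonemptiness supplies the intermediate vertices. -/
theorem MultiHom.add_le_add {α : MultiHom (transTournament a) (transTournament (a + b))}
    {v v' : Fin a} (hv : v < v') {w w' : Fin (a + b)} (hw : w ∈ α.toFun v)
    (hw' : w' ∈ α.toFun v') : (w : ℕ) + v' ≤ w' + v := by
  suffices h : ∀ d (hd : (v : ℕ) + d + 1 < a), ∀ w' ∈ α.toFun ⟨v + d + 1, hd⟩,
      (w : ℕ) + d + 1 ≤ w' by
    have hv' : (v : ℕ) < v' := hv
    have := h (v' - v - 1) (by omega) w' (by convert hw' using 2; ext; simp; omega)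
    omega
  intro d
  induction d with
  | zero => exact fun hd w' hw' => α.adj _ _ (Fin.lt_def.2 (Nat.lt_succ_self _)) w hw w' hw'
  | succ d ih =>
    intro hd w' hw'
    obtain ⟨x, hx⟩ := α.nonempty ⟨v + d + 1, by omega⟩
    have h1 : x < w' := α.adj _ _ (Fin.mk_lt_mk.2 (Nat.lt_succ_self _)) x hx w' hw'
    have h2 := ih (by omega) x hx
    omega

/-- Comparison with the first and the last set leaves room only for v ≤ w ≤ v + b. -/
theorem MultiHom.subset_range_shift (v : Fin a) :
    α.toFun v ⊆ Set.range (shift (b := b) v) := by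
  intro w hw
  have h1 : (v : ℕ) ≤ w := by
    rcases Nat.eq_zero_or_pos v with h | h
    · omega
    · obtain ⟨x, hx⟩ := α.nonempty ⟨0, by omega⟩
      have : (x : ℕ) + v ≤ w + 0 := add_le_add h hx hw
      omega
  have h2 : (w : ℕ) ≤ v + b := by
    rcases Nat.lt_or_ge v (a - 1) with h | h
    · obtain ⟨x, hx⟩ := α.nonempty ⟨a - 1, by omega⟩
      have : (w : ℕ) + (a - 1) ≤ x + v := add_le_add h hw hx
      omega
    · omega
  exact ⟨⟨w - v, by omega⟩, Fin.ext (by simp [shift]; omega)⟩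

/-- The weakly ordered family that corresponds to a multihomomorphism. -/
def MultiHom.unshift (v : Fin a) : Set (Fin (b + 1)) := shift v ⁻¹' α.toFun v

theorem MultiHom.isOrdered_unshift : IsOrdered α.unshift := by
  refine ⟨fun v => ?_, fun v v' hv j hj k hk => ?_⟩
  · obtain ⟨w, hw⟩ := α.nonempty v
    obtain ⟨j, rfl⟩ := α.subset_range_shift v hw
    exact ⟨j, hw⟩
  · have := add_le_add hv hj hk
    simp only [shift] at this
    exact Fin.le_def.2 (by omega)

/-- Adding v to the v-th set makes weak inequalities strict. -/
theorem exists_unshift_eq {N : Fin a → Set (Fin (b + 1))} (hN : IsOrdered N) :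
    ∃ α : MultiHom (transTournament a) (transTournament (a + b)), α.unshift = N := by
  refine ⟨⟨fun v => shift v '' N v, fun v => (hN.nonempty v).image _, ?_⟩, ?_⟩
  · rintro v v' hv _ ⟨j, hj, rfl⟩ _ ⟨k, hk, rfl⟩
    have h1 : (j : ℕ) ≤ k := hN.le v v' hv j hj k hk
    have h2 : (v : ℕ) < v' := hv
    exact Fin.mk_lt_mk.2 (by omega)
  · funext v
    exact Set.preimage_image_eq _ (shift_injective v)

/-- The sum of the points of the simplex that are obtained by shifting the coordinates. -/
def shiftedSum (p : Fin a → Fin (a + b) → ℝ) : EuclideanSpace ℝ (Fin b) :=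
  ∑ v, bary b (p v ∘ shift v)

theorem continuous_shiftedSum : Continuous (shiftedSum (a := a) (b := b)) :=
  continuous_finsetSum _ fun v _ => (continuous_bary b).comp <|
    continuous_pi fun j => (continuous_apply (shift v j)).comp (continuous_apply v)

theorem mem_simplexFace_unshift {p : Fin a → Fin (a + b) → ℝ} (hp : p ∈ α.cell) (v : Fin a) :
    p v ∘ shift v ∈ simplexFace (α.unshift v) := by
  rw [MultiHom.unshift, ← simplexFace_preimage (shift_injective v) (α.subset_range_shift v)]
  exact ⟨p v, hp v trivial, rfl⟩

theorem image_cell : shiftedSum '' α.cell = minkowskiSum α.unshift := by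
  ext x
  rw [mem_minkowskiSum]
  constructor
  · rintro ⟨p, hp, rfl⟩
    exact ⟨fun v => p v ∘ shift v, mem_simplexFace_unshift α hp, rfl⟩
  · rintro ⟨q, hq, rfl⟩
    have : ∀ v, ∃ p ∈ simplexFace (α.toFun v), p ∘ shift v = q v := fun v => by
      have := hq v
      rwa [MultiHom.unshift,
        ← simplexFace_preimage (shift_injective v) (α.subset_range_shift v)] at this
    choose p hp hpq using this
    exact ⟨p, fun v _ => hp v, by simp [shiftedSum, hpq]⟩

theorem injOn_shiftedSum : Set.InjOn (shiftedSum (a := a) (b := b))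
    (support (homComplex (transTournament a) (transTournament (a + b)))) := by
  rintro p ⟨_, ⟨α, rfl⟩, hp⟩ p' ⟨_, ⟨α', rfl⟩, hp'⟩ h
  have heq := eq_of_sum_bary_eq α.isOrdered_unshift α'.isOrdered_unshift
    (mem_simplexFace_unshift α hp) (mem_simplexFace_unshift α' hp') h
  funext v w
  by_cases hw : w ∈ Set.range (shift (b := b) v)
  · obtain ⟨j, rfl⟩ := hw
    exact congrFun (congrFun heq v) j
  · rw [(hp v trivial).2 w fun hw' => hw (α.subset_range_shift v hw'),
      (hp' v trivial).2 w fun hw' => hw (α'.subset_range_shift v hw')]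

theorem image_homComplex (ha : 0 < a) :
    (shiftedSum '' ·) '' homComplex (transTournament a) (transTournament (a + b)) =
      subdivisionComplex (staircase a b) := by
  ext F
  rw [mem_subdivisionComplex_staircase ha]
  constructor
  · rintro ⟨_, ⟨α, rfl⟩, rfl⟩
    exact ⟨_, α.isOrdered_unshift, image_cell α⟩
  · rintro ⟨N, hN, rfl⟩
    obtain ⟨α, rfl⟩ := exists_unshift_eq hN
    exact ⟨_, ⟨α, rfl⟩, image_cell α⟩

/-! ### Compactness and transfer of cells along an injection -/

theorem isCompact_support_homComplex {V W : Type*} [Finite V] [Fintype W] (G : Digraph V)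
    (H : Digraph W) : IsCompact (support (homComplex G H)) := by
  have : Finite (MultiHom G H) := Finite.of_injective MultiHom.toFun fun α β h => by
    cases α; cases β; congr
  refine (Set.finite_range _).isCompact_sUnion ?_
  rintro _ ⟨α, rfl⟩
  exact isCompact_univ_pi fun v => isCompact_simplexFace

/-- A continuous map that is injective on the compact underlying space of a complex is an
isomorphism onto the complex of the images of the cells. -/
theorem exists_homeomorph_preservesCells {E F : Type*} [TopologicalSpace E] [TopologicalSpace F]
    [T2Space F] {K : Set (Set E)} {L : Set (Set F)} {f : E → F} (hf : Continuous f)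
    (hK : IsCompact (support K)) (hinj : Set.InjOn f (support K)) (hL : (f '' ·) '' K = L) :
    ∃ h : support K ≃ₜ support L, PreservesCells K L h := by
  have himage : f '' support K = support L := by
    rw [support, support, Set.sUnion_eq_biUnion, Set.image_iUnion₂, ← hL, Set.sUnion_image]
  have : CompactSpace (support K) := isCompact_iff_compactSpace.1 hK
  let e : support K ≃ support L :=
    (Equiv.Set.imageOfInjOn f (support K) hinj).trans (Equiv.setCongr himage)
  have hval : ∀ x, (e x : F) = f x := fun _ => rfl
  have he : Continuous e := Continuous.subtype_mk (hf.comp continuous_subtype_val) _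
  refine ⟨he.homeoOfEquivCompactToT2, fun A => ?_⟩
  have hA : (Subtype.val '' (he.homeoOfEquivCompactToT2 '' A) : Set F) =
      f '' (Subtype.val '' A) := by
    rw [Set.image_image, Set.image_image]
    rfl
  rw [hA, ← hL]
  refine ⟨fun h => ⟨_, h, rfl⟩, ?_⟩
  rintro ⟨B, hB, hBA⟩
  -- Injectivity on the support identifies the cell `B` with `A`, as they have the same image.
  rwa [← (hinj.image_eq_image_iff (Set.subset_sUnion_of_mem hB)
    (Subtype.coe_image_subset _ A)).1 hBA]

end Tournament

end

end TournamentHom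

theorem mainTheorem8 (m n : ℕ) (hm : 2 ≤ m) (hmn : m ≤ n) :
    (IsMixedSubdivision (fun _ : Fin m => simplex (n - m)) (staircase m (n - m)) ∧
      support (subdivisionComplex (staircase m (n - m))) = (m : ℝ) • simplex (n - m)) ∧
    (∃ h : support (homComplex (transTournament m) (transTournament n)) ≃ₜ
        support (subdivisionComplex (staircase m (n - m))),
      PreservesCells (homComplex (transTournament m) (transTournament n))
        (subdivisionComplex (staircase m (n - m))) h) ∧
    Nonempty (support (homComplex (transTournament m) (transTournament n)) ≃ₜ
      Metric.closedBall (0 : EuclideanSpace ℝ (Fin (n - m))) 1) := by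
  obtain ⟨b, rfl⟩ := Nat.exists_eq_add_of_le hmn
  have ha : 0 < m := by omega
  generalize hb : m + b - m = c
  obtain rfl : c = b := by omega
  have hsupport : support (subdivisionComplex (staircase m c)) = ∑ _i : Fin m, simplex c := by
    rw [support_subdivisionComplex, iUnion_staircase ha]
  obtain ⟨h, hh⟩ := exists_homeomorph_preservesCells continuous_shiftedSum
    (isCompact_support_homComplex _ _) injOn_shiftedSum (image_homComplex (b := c) ha)
  refine ⟨⟨isMixedSubdivision_staircase ha, hsupport.trans (sum_simplex_eq_smul m)⟩, ⟨h, hh⟩, ?_⟩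
  obtain ⟨e⟩ := nonempty_homeomorph_closedBall (b := c) ha
  exact ⟨(h.trans (Homeomorph.setCongr hsupport)).trans e⟩
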